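/- **Setting.** Let $X\ge 1$, $L\ge 0$ be integers, $A$ an $X\times X$ stochastic matrix, and $D_1,\dots,D_L$ positive integers. A Markov chain $x_t$ on $\{e_1,\dots,e_X\}$ with transition matrix $A$ is observed at sampling times $\tau_k$: an observation made in state $e_i$ has density $B_{iy}$ with respect to a fixed $\sigma$-finite measure $dy$ on a linearly ordered measurable space $\mathbb Y$ (e.g. Lebesgue measure on a subset of $\mathbb R$ or counting measure on a subset of $\mathbb Z$). At each decision time an action $u\in\mathcal U=\{0,1,\dots,L\}$ is chosen: $u=0$ stops the problem, and $u\ge 1$ means that the next observation is taken after $D_u$ time steps. The cost vectors are $C_0=(c(e_i,0))_i$ and $C_u=m_u+(I+A+\dots+A^{D_u-1})c_u$ for $u\ge1$, where $c_u=(c(e_i,u))_i$ and $m_u=(m(e_i,u))_i$ are the running and measurement costs; put $C(\pi,u)=C_u'\pi$ and assume that all entries $C(e_i,u)$ are non-negative. Beliefs live on the unit simplex $\Pi(X)$ and are updated by the Bayesian filter $T(\pi,y,u)=B_y(A')^{D_u}\pi/\sigma(\pi,y,u)$, $\sigma(\pi,y,u)=\mathbf 1'B_y(A')^{D_u}\pi$,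 where $B_y=\mathrm{diag}(B_{1y},\dots,B_{Xy})$. For a (measurable) stationary strategy $\mu:\Pi(X)\to\mathcal U$ let $J_\mu(\pi)=\mathbb E^\mu_\pi\{\sum_{k<k^*}C(\pi_k,u_k)+C(\pi_{k^*},0)\}$, where $\pi_k$ is the belief at the $k$-th decision (the first one being $\pi$), $u_k=\mu(\pi_k)$, and $k^*$ is the first $k$ with $u_k=0$ (if $k^*=\infty$, the cost is the infinite sum of the $C(\pi_k,u_k)$). Let $V(\pi)=\inf_\mu J_\mu(\pi)$, $Q(\pi,0)=C(\pi,0)$ and $Q(\pi,u)=C(\pi,u)+\int_{\mathbb Y}V(T(\pi,y,u))\,\sigma(\pi,y,u)\,dy$ for $u\ge1$. The optimal strategy is $\mu^*(\pi)\in\arg\min_{u\in\mathcal U}Q(\pi,u)$, and the myopic strategy is $\underline\mu(\pi)\in\arg\min_{u\in\mathcal U}C(\pi,u)$. The stopping sets are $$\mathcal S=\{\pi\in\Pi(X):Q(\pi,0)\le Q(\pi,u),\ 1\le u\le L\},\qquad \underline{\mathcal S}=\{\pi\in\Pi(X):C(\pi,0)<C(\pi,u),\ 1\le u\le L\}.$$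 Write $\pi\ge_r\bar\pi$ (MLR order) if $\pi(i)\bar\pi(j)\le\bar\pi(i)\pi(j)$ for all $i<j$. For sets $S,S'$ of actions, $S\le S'$ means that $\min(a,b)\in S$ and $\max(a,b)\in S'$ whenever $a\in S$, $b\in S'$. For one-point sets this is $\le$; for nonempty sets it implies the inequality for the smallest and for the largest elements. Since minimizers need not be unique, inequalities between minimizing strategies are understood as this order between the sets of minimizers. **Assumptions.** "Increasing" and "decreasing" are in the weak sense. (A1) $C(e_i,u)$ is increasing in $i$ for each $u\in\mathcal U$, and $e_1\in\mathcal S$. (A2) $A$ is TP2 (all second order minors are non-negative). (A3) $B$ is TP2: $B_{iy'}B_{jy}\le B_{iy}B_{jy'}$ for all $i<j$ and $y<y'$. (A4) $C(e_i,u+1)-C(e_i,u)$ is decreasing in $i$ for $1\le u\le L-1$. (A6) $A\succeq A^2$, that is, $A_{ij}(A^2)_{mk}\le (A^2)_{ij}A_{mk}$ for all $i,m$ and all $j<k$. **Theorem.** 1. $\mathcal S$ is a convex subset of $\Pi(X)$. 2. $\underline{\mathcal S}\subseteq\mathcal S$. 3. Under (A1), (A2), (A3), (A6), and with the delays labelled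 so that $D_1<D_2<\dots<D_L$, the myopic strategy is a lower bound for the optimal strategy outside the stopping set: for every $\pi\in\Pi(X)\setminus\mathcal S$, $\arg\min_{u\in\mathcal U}C(\pi,u)\le\arg\min_{u\in\mathcal U}Q(\pi,u)$. 4. Under (A4), the myopic choice among the actions that continue is MLR-increasing: $\pi\ge_r\bar\pi$ implies $\arg\min_{1\le u\le L}C(\bar\pi,u)\le\arg\min_{1\le u\le L}C(\pi,u)$. (Outside $\underline{\mathcal S}$ a minimizer over $1\le u\le L$ is also a minimizer over $\mathcal U$, so this is monotonicity of the myopic strategy there.) If the condition in (A4) also holds for $u=0$, that is, for all $0\le u\le L-1$, then the whole myopic strategy is MLR-increasing on $\Pi(X)$: $\pi\ge_r\bar\pi$ implies $\arg\min_{u\in\mathcal U}C(\bar\pi,u)\le\arg\min_{u\in\mathcal U}C(\pi,u)$. -/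

import Mathlib

open MeasureTheory ProbabilityTheory
open scoped ENNReal Matrix

noncomputable section

/-- A function of two ordered arguments is totally positive of order 2:
all of its second order minors are non-negative. -/
def IsTP2 {α β : Type*} [LT α] [LT β] (f : α → β → ℝ) : Prop :=
  ∀ i j : α, ∀ k l : β, i < j → k < l → f i l * f j k ≤ f i k * f j l

/-- `MLRGe p q`: the vector `p` dominates `q` in the monotone likelihood ratio order. -/
def MLRGe {X : ℕ} (p q : Fin X → ℝ) : Prop :=
  ∀ i j : Fin X, i < j → p i * q j ≤ q i * p j

/-- The order `P ⪰ R` on transition matrices. -/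
def TransGe {X : ℕ} (P R : Matrix (Fin X) (Fin X) ℝ) : Prop :=
  ∀ i m j k : Fin X, j < k → P i j * R m k ≤ R i j * P m k

/-- The (strong) set order `S ≤ T` on sets of actions, which compares set-valued minimizers.
For one-point sets this is `≤`; in general it implies that the least element of `S` is at most
that of `T`, and likewise for the greatest elements. -/
def SetLE {n : ℕ} (S T : Set (Fin n)) : Prop :=
  ∀ a ∈ S, ∀ b ∈ T, min a b ∈ S ∧ max a b ∈ T

/-- Data of the sampling problem. States are `0, …, X - 1` (state `0` is the target state),
actions are `0` (stop) and `1, …, L`, where `u ≥ 1` means: take the next observation after `D u`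
time steps. The observation given state `x` has density `B x` with respect to `ν`
(for instance Lebesgue measure on a subset of `ℝ`, or counting measure on a subset of `ℤ`).
The value `D 0` and the values `m · 0` have no meaning and are never used in a cost. -/
structure SamplingModel (X L : ℕ) (Y : Type*) [MeasurableSpace Y] where
  /-- transition matrix -/
  A : Matrix (Fin X) (Fin X) ℝ
  A_stochastic : A ∈ Matrix.rowStochastic ℝ (Fin X)
  /-- reference measure on the observation space -/
  ν : Measure Y
  sigmaFinite : SigmaFinite ν
  /-- observation densities -/
  B : Fin X → Y → ℝ
  B_nonneg : ∀ x y, 0 ≤ B x y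
  B_measurable : ∀ x, Measurable (B x)
  B_lintegral : ∀ x, ∫⁻ y, ENNReal.ofReal (B x y) ∂ν = 1
  /-- sampling delays -/
  D : Fin (L + 1) → ℕ
  D_pos : ∀ u, u ≠ 0 → 0 < D u
  /-- running cost (and, for `u = 0`, stopping cost) -/
  c : Fin X → Fin (L + 1) → ℝ
  /-- measurement cost -/
  m : Fin X → Fin (L + 1) → ℝ

/-- Stationary strategies: measurable maps from beliefs to actions. -/
abbrev Strategy (X L : ℕ) : Type := {μ : (Fin X → ℝ) → Fin (L + 1) // Measurable μ}

namespace SamplingModel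

variable {X L : ℕ} {Y : Type*} [MeasurableSpace Y] (M : SamplingModel X L Y)

/-! ### Costs -/

/-- The cost vector `C_u`; its `i`-th entry is `C(e_i, u)`. -/
def costVec (u : Fin (L + 1)) : Fin X → ℝ :=
  if u = 0 then fun i => M.c i 0
  else (fun i => M.m i u) + (∑ s ∈ Finset.range (M.D u), M.A ^ s) *ᵥ (fun i => M.c i u)

/-- The expected cost `C(π, u) = C_u' π`. -/
def cost (u : Fin (L + 1)) (π : Fin X → ℝ) : ℝ := M.costVec u ⬝ᵥ π

/-! ### Bayesian filter -/

/-- The predictor `(A')^{D_u} π`. -/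
def pred (π : Fin X → ℝ) (u : Fin (L + 1)) : Fin X → ℝ := (M.Aᵀ ^ M.D u) *ᵥ π

/-- The normalization `σ(π, y, u)`. -/
def sigma (π : Fin X → ℝ) (y : Y) (u : Fin (L + 1)) : ℝ := ∑ j, M.B j y * M.pred π u j

/-- The updated belief `T(π, y, u)` (irrelevant where `σ(π, y, u) = 0`). -/
def filter (π : Fin X → ℝ) (y : Y) (u : Fin (L + 1)) : Fin X → ℝ :=
  fun j => M.B j y * M.pred π u j / M.sigma π y u

/-! ### The controlled process
The process is observed at the sampling times `τ_k`; its state at `τ_k` is the pair consisting of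
the hidden state `x_{τ_k}` and the belief `π_k`. -/

/-- The law of the observation in a given state. -/
def obsLaw (x : Fin X) : Measure Y := M.ν.withDensity fun y => ENNReal.ofReal (M.B x y)

/-- The joint law of the hidden state at the next sampling time and of the observation made there,
given the present hidden state and the action. -/
def stepLaw : Kernel (Fin X × Fin (L + 1)) (Fin X × Y) :=
  Kernel.ofFunOfCountable fun s =>
    ∑ x', ENNReal.ofReal ((M.A ^ M.D s.2) s.1 x') • (M.obsLaw x').map (fun y => (x', y))

instance (x : Fin X) : IsProbabilityMeasure (M.obsLaw x) :=
  ⟨by simp [obsLaw, M.B_lintegral]⟩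

instance : IsMarkovKernel M.stepLaw := by
  refine ⟨fun s => ⟨?_⟩⟩
  have hA : M.A ^ M.D s.2 ∈ Matrix.rowStochastic ℝ (Fin X) := pow_mem M.A_stochastic _
  rw [Matrix.mem_rowStochastic_iff_sum] at hA
  have h : ∀ x' : Fin X, ((M.obsLaw x').map (fun y => (x', y))) Set.univ = 1 := fun x' => by
    rw [Measure.map_apply measurable_prodMk_left MeasurableSet.univ]; simp
  change (∑ x', ENNReal.ofReal ((M.A ^ M.D s.2) s.1 x') •
    (M.obsLaw x').map (fun y => (x', y)) : Measure (Fin X × Y)) Set.univ = 1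
  simp only [Measure.coe_finsetSum, Finset.sum_apply, Measure.smul_apply, h, smul_eq_mul, mul_one]
  rw [← ENNReal.ofReal_sum_of_nonneg fun x' _ => hA.1 _ _, hA.2, ENNReal.ofReal_one]

/-- The new (hidden state, belief) pair from the old one and the new hidden state and
observation. -/
def update (μ : Strategy X L) (z : (Fin X × (Fin X → ℝ)) × (Fin X × Y)) : Fin X × (Fin X → ℝ) :=
  (z.2.1, M.filter z.1.2 z.2.2 (μ.1 z.1.2))

theorem measurable_filter (u : Fin (L + 1)) :
    Measurable fun z : (Fin X → ℝ) × Y => M.filter z.1 z.2 u := by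
  have hB : ∀ j, Measurable fun z : (Fin X → ℝ) × Y => M.B j z.2 :=
    fun j => (M.B_measurable j).comp measurable_snd
  have hp : ∀ j, Measurable fun z : (Fin X → ℝ) × Y => M.pred z.1 u j := fun j => by
    unfold pred Matrix.mulVec dotProduct
    fun_prop
  unfold filter sigma
  exact measurable_pi_lambda _ fun j => ((hB j).mul (hp j)).div
    (Finset.measurable_sum _ fun i _ => (hB i).mul (hp i))

theorem measurable_update (μ : Strategy X L) : Measurable (M.update μ) := by
  have hμ : Measurable fun z : (Fin X × (Fin X → ℝ)) × (Fin X × Y) => μ.1 z.1.2 :=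
    μ.2.comp (measurable_snd.comp measurable_fst)
  have h : Measurable fun w : ((Fin X → ℝ) × Y) × Fin (L + 1) => M.filter w.1.1 w.1.2 w.2 :=
    measurable_from_prod_countable_left fun u => M.measurable_filter u
  exact (measurable_fst.comp measurable_snd).prodMk
    (h.comp (((measurable_snd.comp measurable_fst).prodMk
      (measurable_snd.comp measurable_snd)).prodMk hμ))

/-- The one-step transition kernel of (hidden state, belief) under the strategy `μ`. -/
def transition (μ : Strategy X L) : Kernel (Fin X × (Fin X → ℝ)) (Fin X × (Fin X → ℝ)) :=
  (Kernel.id ×ₖ M.stepLaw.comap (fun s => (s.1, μ.1 s.2))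
    (measurable_fst.prodMk (μ.2.comp measurable_snd))).map (M.update μ)

instance (μ : Strategy X L) : IsMarkovKernel (M.transition μ) :=
  Kernel.IsMarkovKernel.map _ (M.measurable_update μ)

/-- The law of the whole process under the strategy `μ`, started at the hidden state and belief
`s`. -/
def pathLaw (μ : Strategy X L) (s : Fin X × (Fin X → ℝ)) :
    Measure (ℕ → Fin X × (Fin X → ℝ)) :=
  Kernel.traj (X := fun _ => Fin X × (Fin X → ℝ))
    (fun n => (M.transition μ).comap (fun h => h ⟨n, Finset.mem_Iic.2 le_rfl⟩)
      (measurable_pi_apply _)) 0 (fun _ => s)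

open Classical in
/-- The total cost along a path: `C(π_k, u_k)` is paid for every `k` up to and including the first
`k` with `u_k = 0` (for every `k` if there is no such one). -/
def totalCost (μ : Strategy X L) (ω : ℕ → Fin X × (Fin X → ℝ)) : ℝ≥0∞ :=
  ∑' k, if ∀ j < k, μ.1 (ω j).2 ≠ 0
    then ENNReal.ofReal (M.cost (μ.1 (ω k).2) (ω k).2) else 0

/-- The objective `J_μ(π)`: the expected total cost under `μ` when the hidden state is initially
distributed according to the initial belief `π`. -/
def objective (μ : Strategy X L) (π : Fin X → ℝ) : ℝ≥0∞ :=
  ∑ i, ENNReal.ofReal (π i) * ∫⁻ ω, M.totalCost μ ω ∂M.pathLaw μ (i, π)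

/-- The optimal cost `V(π)`. -/
def value (π : Fin X → ℝ) : ℝ≥0∞ := ⨅ μ : Strategy X L, M.objective μ π

/-- The function `Q(π, u)` of the dynamic programming equation. -/
def Q (π : Fin X → ℝ) (u : Fin (L + 1)) : ℝ≥0∞ :=
  if u = 0 then ENNReal.ofReal (M.cost 0 π)
  else ENNReal.ofReal (M.cost u π) +
    ∫⁻ y, M.value (M.filter π y u) * ENNReal.ofReal (M.sigma π y u) ∂M.ν

/-! ### Strategies and stopping sets -/

/-- The actions that an optimal strategy may take at `π`: minimizers of `Q(π, ·)`. -/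
def optimalActions (π : Fin X → ℝ) : Set (Fin (L + 1)) := {u | ∀ v, M.Q π u ≤ M.Q π v}

/-- The actions that the myopic strategy may take at `π`: minimizers of `C(π, ·)`. -/
def myopicActions (π : Fin X → ℝ) : Set (Fin (L + 1)) := {u | ∀ v, M.cost u π ≤ M.cost v π}

/-- The minimizers of `C(π, ·)` among the actions `1, …, L`. Outside the myopic stopping set these
are exactly the nonzero elements of `myopicActions π`. -/
def myopicContinueActions (π : Fin X → ℝ) : Set (Fin (L + 1)) :=
  {u | u ≠ 0 ∧ ∀ v, v ≠ 0 → M.cost u π ≤ M.cost v π}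

/-- The optimal stopping set. -/
def stoppingSet : Set (Fin X → ℝ) :=
  {π | π ∈ stdSimplex ℝ (Fin X) ∧ ∀ u, u ≠ 0 → M.Q π 0 ≤ M.Q π u}

/-- The myopic stopping set. -/
def myopicStoppingSet : Set (Fin X → ℝ) :=
  {π | π ∈ stdSimplex ℝ (Fin X) ∧ ∀ u, u ≠ 0 → M.cost 0 π < M.cost u π}

/-! ### Assumptions -/

/-- Costs increase with the state, and the target state belongs to the stopping set. -/
def A1 [NeZero X] : Prop :=
  (∀ u, Monotone (M.costVec u)) ∧ Pi.single (0 : Fin X) (1 : ℝ) ∈ M.stoppingSet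

/-- The transition matrix is TP2. -/
def A2 : Prop := IsTP2 M.A

/-- The observation densities are TP2. -/
def A3 [LT Y] : Prop := IsTP2 M.B

/-- The costs are submodular on the actions `1, …, L`. -/
def A4 : Prop :=
  ∀ u v : Fin (L + 1), u ≠ 0 → (v : ℕ) = u + 1 → Antitone fun i => M.costVec v i - M.costVec u i

/-- The costs are submodular on all actions `0, 1, …, L`. -/
def A4Full : Prop :=
  ∀ u v : Fin (L + 1), (v : ℕ) = u + 1 → Antitone fun i => M.costVec v i - M.costVec u i

/-- `A ⪰ A²`. -/
def A6 : Prop := TransGe M.A (M.A ^ 2)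

end SamplingModel

end

/-! The optimal cost is the increasing limit of value iteration started at `0`
(`value_eq_valueLimit`). With non-negative costs no transversality condition is needed: the `n`-th
iterate bounds the `n`-stage cost of every strategy from below, and a measurable strategy that is
greedy for the limit never costs more than the limit. The passage from the chain of hidden states
and beliefs to beliefs alone is Bayes' rule (`sum_mul_killedStep`).

Value functions are extended to positively homogeneous functions on the orthant. Then `f (T π) * σ`
is `f` of the unnormalized posterior, which is linear in the prior; normalization disappears and
concavity becomes superadditivity. Value iteration preserves this property, so each `Q(·, u)` is
concave while the stopping cost is linear, whence the stopping set is convex. It contains the myopic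
one because continuation costs are non-negative.

For the lower bound, value iteration also preserves monotonicity in the likelihood ratio order; the
crux is integration over observations (`A3.isMLRMono_postIntegral`). Since `A ⪰ A²` and `A` is TP2,
the predictor decreases in this order as the delay grows, so the expected cost to go decreases with
the delay (`postIntegral_pred_le`). A longer delay that is myopically no worse is thus no worse
overall. Monotonicity of the myopic strategy is the usual exchange argument for submodular costs,
since decreasing differences survive averaging over ordered beliefs. -/

/-! ### The monotone likelihood ratio order -/

/-- The two-point case of the basic composition formula for totally positive functions. -/
theorem MLRGe.dotProduct_mul_le {X : ℕ} {p q f g : Fin X → ℝ} (hpq : MLRGe p q)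
    (hfg : ∀ i j, i < j → f j * g i ≤ f i * g j) :
    (p ⬝ᵥ f) * (q ⬝ᵥ g) ≤ (q ⬝ᵥ f) * (p ⬝ᵥ g) := by
  have expand : ∀ a b c d : Fin X → ℝ,
      (a ⬝ᵥ b) * (c ⬝ᵥ d) = ∑ i, ∑ j, (a i * b i) * (c j * d j) := fun a b c d => by
    simp only [dotProduct, Finset.sum_mul_sum]
  have swap : ∀ a b c d : Fin X → ℝ,
      (a ⬝ᵥ b) * (c ⬝ᵥ d) = ∑ i, ∑ j, (a j * b j) * (c i * d i) := fun a b c d => by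
    rw [expand, Finset.sum_comm]
  -- Swapping `i` and `j` changes the sign of both factors, so every summand is non-negative;
  -- summing over all ordered pairs gives twice the desired difference.
  have key : 0 ≤ ∑ i, ∑ j, (q i * p j - p i * q j) * (f i * g j - f j * g i) := by
    refine Finset.sum_nonneg fun i _ => Finset.sum_nonneg fun j _ => ?_
    rcases lt_trichotomy i j with h | rfl | h
    · exact mul_nonneg (sub_nonneg.2 (hpq i j h)) (sub_nonneg.2 (hfg i j h))
    · simp
    · exact mul_nonneg_of_nonpos_of_nonpos (by linarith [hpq j i h]) (by linarith [hfg j i h])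
  have split : ∑ i, ∑ j, (q i * p j - p i * q j) * (f i * g j - f j * g i) =
      2 * ((q ⬝ᵥ f) * (p ⬝ᵥ g)) - 2 * ((p ⬝ᵥ f) * (q ⬝ᵥ g)) := by
    rw [two_mul, two_mul]
    nth_rw 1 [expand q f p g]
    rw [swap q f p g]
    nth_rw 1 [expand p f q g]
    rw [swap p f q g]
    simp only [← Finset.sum_add_distrib, ← Finset.sum_sub_distrib]
    exact Finset.sum_congr rfl fun i _ => Finset.sum_congr rfl fun j _ => by ring
  linarith

/-- Vectors ordered by likelihood ratio are stochastically ordered. -/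
theorem MLRGe.sum_mul_dotProduct_le {X : ℕ} {p q g : Fin X → ℝ} (hpq : MLRGe p q)
    (hg : Monotone g) : (∑ i, p i) * (q ⬝ᵥ g) ≤ (∑ i, q i) * (p ⬝ᵥ g) := by
  have h := hpq.dotProduct_mul_le (f := fun _ => 1) (g := g)
    fun i j hij => by simpa using hg hij.le
  simpa [dotProduct] using h

theorem MLRGe.transpose_mulVec {X : ℕ} {A : Matrix (Fin X) (Fin X) ℝ} {p q : Fin X → ℝ}
    (hA : IsTP2 A) (hpq : MLRGe p q) : MLRGe (Aᵀ *ᵥ p) (Aᵀ *ᵥ q) := by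
  intro k l hkl
  have h := hpq.dotProduct_mul_le (f := fun i => A i k) (g := fun i => A i l)
    fun i j hij => by linarith [hA i j k l hij hkl]
  simpa [Matrix.mulVec, dotProduct, mul_comm] using h

theorem MLRGe.transpose_pow_mulVec {X : ℕ} {A : Matrix (Fin X) (Fin X) ℝ} {p q : Fin X → ℝ}
    (hA : IsTP2 A) (hpq : MLRGe p q) (d : ℕ) : MLRGe ((Aᵀ ^ d) *ᵥ p) ((Aᵀ ^ d) *ᵥ q) := by
  induction d with
  | zero => simpa using hpq
  | succ d ih =>
    rw [pow_succ', ← Matrix.mulVec_mulVec, ← Matrix.mulVec_mulVec]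
    exact ih.transpose_mulVec hA

/-- Both products expand into double sums over rows `i`, `m` with common weight `p i * p m`. The
order on matrices compares all pairs of rows, so the comparison is termwise. -/
theorem TransGe.mlrGe_mulVec {X : ℕ} {P R : Matrix (Fin X) (Fin X) ℝ} (h : TransGe P R)
    {p : Fin X → ℝ} (hp : 0 ≤ p) : MLRGe (Pᵀ *ᵥ p) (Rᵀ *ᵥ p) := by
  intro j k hjk
  simp only [Matrix.mulVec, dotProduct, Matrix.transpose_apply, Finset.sum_mul_sum]
  refine Finset.sum_le_sum fun i _ => Finset.sum_le_sum fun m _ => ?_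
  have := mul_le_mul_of_nonneg_left (h i m j k hjk) (mul_nonneg (hp i) (hp m))
  linarith

/-! ### Predictors and the prediction horizon. -/

namespace SamplingModel

variable {X L : ℕ} {Y : Type*} [MeasurableSpace Y] (M : SamplingModel X L Y)

theorem A_pow_mem (d : ℕ) : M.A ^ d ∈ Matrix.rowStochastic ℝ (Fin X) :=
  pow_mem M.A_stochastic d

theorem transpose_pow_mulVec_nonneg (d : ℕ) {p : Fin X → ℝ} (hp : 0 ≤ p) :
    0 ≤ (M.Aᵀ ^ d) *ᵥ p := by
  have h := (Matrix.mem_rowStochastic_iff_sum.1 (M.A_pow_mem d)).1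
  intro j
  rw [← Matrix.transpose_pow]
  change 0 ≤ ∑ i, (M.A ^ d) i j * p i
  exact Finset.sum_nonneg fun i _ => mul_nonneg (h i j) (hp i)

theorem sum_transpose_pow_mulVec (d : ℕ) (p : Fin X → ℝ) :
    ∑ j, ((M.Aᵀ ^ d) *ᵥ p) j = ∑ i, p i := by
  have h := (Matrix.mem_rowStochastic_iff_sum.1 (M.A_pow_mem d)).2
  simp only [← Matrix.transpose_pow, Matrix.mulVec, dotProduct, Matrix.transpose_apply]
  rw [Finset.sum_comm]
  exact Finset.sum_congr rfl fun i _ => by rw [← Finset.sum_mul, h, one_mul]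

theorem pred_nonneg (u : Fin (L + 1)) {p : Fin X → ℝ} (hp : 0 ≤ p) : 0 ≤ M.pred p u :=
  M.transpose_pow_mulVec_nonneg _ hp

theorem sum_pred (u : Fin (L + 1)) (p : Fin X → ℝ) : ∑ j, M.pred p u j = ∑ i, p i :=
  M.sum_transpose_pow_mulVec _ p

theorem pred_add (p q : Fin X → ℝ) (u : Fin (L + 1)) :
    M.pred (p + q) u = M.pred p u + M.pred q u :=
  Matrix.mulVec_add _ _ _

theorem pred_smul (a : ℝ) (p : Fin X → ℝ) (u : Fin (L + 1)) :
    M.pred (a • p) u = a • M.pred p u :=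
  Matrix.mulVec_smul _ _ _

/-- Under `A ⪰ A²`, a longer prediction horizon gives a smaller predictor. -/
theorem A6.mlrGe_transpose_pow {M : SamplingModel X L Y} (h2 : M.A2) (h6 : M.A6)
    {p : Fin X → ℝ} (hp : 0 ≤ p) (d : ℕ) :
    MLRGe ((M.Aᵀ ^ (d + 1)) *ᵥ p) ((M.Aᵀ ^ (d + 2)) *ᵥ p) := by
  have h := (TransGe.mlrGe_mulVec h6 hp).transpose_pow_mulVec h2 d
  rwa [Matrix.transpose_pow, Matrix.mulVec_mulVec, Matrix.mulVec_mulVec, ← pow_succ,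
    ← pow_add] at h

/-! ### The unnormalized posterior -/

/-- The unnormalized posterior `B_y p`. -/
def post (p : Fin X → ℝ) (y : Y) : Fin X → ℝ := fun j => M.B j y * p j

theorem post_nonneg {p : Fin X → ℝ} (hp : 0 ≤ p) (y : Y) : 0 ≤ M.post p y :=
  fun j => mul_nonneg (M.B_nonneg j y) (hp j)

theorem post_add (p q : Fin X → ℝ) (y : Y) : M.post (p + q) y = M.post p y + M.post q y := by
  ext j; simp [post, mul_add]

theorem post_smul (a : ℝ) (p : Fin X → ℝ) (y : Y) : M.post (a • p) y = a • M.post p y := by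
  ext j; simp [post, mul_left_comm]

theorem measurable_post : Measurable fun z : (Fin X → ℝ) × Y => M.post z.1 z.2 :=
  measurable_pi_lambda _ fun j =>
    ((M.B_measurable j).comp measurable_snd).mul ((measurable_pi_apply j).comp measurable_fst)

theorem lintegral_sum_post {p : Fin X → ℝ} (hp : 0 ≤ p) :
    ∫⁻ y, ENNReal.ofReal (∑ j, M.post p y j) ∂M.ν = ENNReal.ofReal (∑ j, p j) := by
  have h : ∀ y, ENNReal.ofReal (∑ j, M.post p y j) =
      ∑ j, ENNReal.ofReal (M.B j y) * ENNReal.ofReal (p j) := fun y => by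
    rw [ENNReal.ofReal_sum_of_nonneg fun j _ => M.post_nonneg hp y j]
    exact Finset.sum_congr rfl fun j _ => ENNReal.ofReal_mul (M.B_nonneg j y)
  simp_rw [h]
  rw [lintegral_finsetSum _ fun j _ => (M.B_measurable j).ennreal_ofReal.mul_const _,
    ENNReal.ofReal_sum_of_nonneg fun j _ => hp j]
  refine Finset.sum_congr rfl fun j _ => ?_
  rw [lintegral_mul_const _ (M.B_measurable j).ennreal_ofReal, M.B_lintegral, one_mul]

theorem mlrGe_post {p q : Fin X → ℝ} (hpq : MLRGe p q) (y : Y) :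
    MLRGe (M.post p y) (M.post q y) := fun i j hij => by
  have := mul_le_mul_of_nonneg_left (hpq i j hij) (mul_nonneg (M.B_nonneg i y) (M.B_nonneg j y))
  simp only [post]
  linarith

theorem A3.mlrGe_post {M : SamplingModel X L Y} [LinearOrder Y] (h3 : M.A3) {p q : Fin X → ℝ}
    (hp : 0 ≤ p) (hq : 0 ≤ q) (hpq : MLRGe p q) {y y' : Y} (hy : y < y') :
    MLRGe (M.post p y') (M.post q y) := fun i j hij => by
  have h := mul_le_mul (h3 i j y y' hij hy) (hpq i j hij) (mul_nonneg (hp i) (hq j))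
    (mul_nonneg (M.B_nonneg i y) (M.B_nonneg j y'))
  simp only [post]
  linarith

/-- The composition formula with the likelihoods of two observations as test functions: a larger
prior makes larger observations relatively more likely. -/
theorem A3.sum_post_mul_le {M : SamplingModel X L Y} [LinearOrder Y] (h3 : M.A3)
    {p q : Fin X → ℝ} (hpq : MLRGe p q) {y y' : Y} (hy : y < y') :
    (∑ j, M.post p y j) * (∑ j, M.post q y' j) ≤ (∑ j, M.post q y j) * ∑ j, M.post p y' j := by
  have h := hpq.dotProduct_mul_le (f := fun i => M.B i y) (g := fun i => M.B i y')
    fun i j hij => by linarith [h3 i j y y' hij hy]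
  simpa [dotProduct, post, mul_comm] using h

theorem post_of_sum_eq_zero {p : Fin X → ℝ} (hp : 0 ≤ p) (h : ∑ i, p i = 0) : p = 0 :=
  funext fun i => (Finset.sum_eq_zero_iff_of_nonneg fun i _ => hp i).1 h i (Finset.mem_univ i)

/-! ### Dynamic programming operators -/

/-- The integral of `f` over the unnormalized posteriors of `p`. -/
noncomputable def postIntegral (f : (Fin X → ℝ) → ℝ≥0∞) (p : Fin X → ℝ) : ℝ≥0∞ := ∫⁻ y, f (M.post p y) ∂M.ν

/-- The cost of taking the action `u` and then paying `f` of the unnormalized posterior. -/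
noncomputable def lookahead (f : (Fin X → ℝ) → ℝ≥0∞) (u : Fin (L + 1)) (π : Fin X → ℝ) : ℝ≥0∞ :=
  ENNReal.ofReal (M.cost u π) + if u = 0 then 0 else M.postIntegral f (M.pred π u)

/-- The Bellman operator. -/
noncomputable def bellman (f : (Fin X → ℝ) → ℝ≥0∞) (π : Fin X → ℝ) : ℝ≥0∞ := ⨅ u, M.lookahead f u π

/-- The iterates of the Bellman operator, started at `0`. -/
noncomputable def valueIter : ℕ → (Fin X → ℝ) → ℝ≥0∞
  | 0 => 0
  | n + 1 => M.bellman (valueIter n)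

/-- The limit of value iteration. -/
noncomputable def valueLimit (π : Fin X → ℝ) : ℝ≥0∞ := ⨆ n, M.valueIter n π

theorem measurable_pred (u : Fin (L + 1)) : Measurable fun π : Fin X → ℝ => M.pred π u := by
  refine measurable_pi_lambda _ fun j => ?_
  unfold pred Matrix.mulVec dotProduct
  fun_prop

theorem measurable_cost (u : Fin (L + 1)) : Measurable (M.cost u) := by
  unfold cost dotProduct
  fun_prop

theorem measurable_postIntegral {f : (Fin X → ℝ) → ℝ≥0∞} (hf : Measurable f) :
    Measurable (M.postIntegral f) := by
  have := M.sigmaFinite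
  exact Measurable.lintegral_prod_right' (f := fun z : (Fin X → ℝ) × Y => f (M.post z.1 z.2))
    (hf.comp M.measurable_post)

theorem measurable_lookahead {f : (Fin X → ℝ) → ℝ≥0∞} (hf : Measurable f) (u : Fin (L + 1)) :
    Measurable (M.lookahead f u) := by
  unfold lookahead
  refine (M.measurable_cost u).ennreal_ofReal.add ?_
  split_ifs
  · exact measurable_const
  · exact (M.measurable_postIntegral hf).comp (M.measurable_pred u)

theorem measurable_bellman {f : (Fin X → ℝ) → ℝ≥0∞} (hf : Measurable f) :
    Measurable (M.bellman f) :=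
  Measurable.iInf fun u => M.measurable_lookahead hf u

theorem measurable_valueIter (n : ℕ) : Measurable (M.valueIter n) := by
  induction n with
  | zero => exact measurable_const
  | succ n ih => exact M.measurable_bellman ih

theorem measurable_valueLimit : Measurable M.valueLimit :=
  Measurable.iSup M.measurable_valueIter

theorem lookahead_mono {f g : (Fin X → ℝ) → ℝ≥0∞} (h : f ≤ g) (u : Fin (L + 1)) :
    M.lookahead f u ≤ M.lookahead g u := by
  intro π
  unfold lookahead
  gcongr
  split_ifs
  · exact le_rfl
  · exact lintegral_mono fun y => h _

theorem valueIter_mono : Monotone M.valueIter := by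
  refine monotone_nat_of_le_succ fun n => ?_
  induction n with
  | zero => exact fun π => zero_le
  | succ n ih => exact fun π => iInf_mono fun u => M.lookahead_mono ih u π

theorem lookahead_valueLimit (u : Fin (L + 1)) (π : Fin X → ℝ) :
    M.lookahead M.valueLimit u π = ⨆ n, M.lookahead (M.valueIter n) u π := by
  unfold lookahead
  split_ifs with h
  · simp
  · rw [← ENNReal.add_iSup]
    congr 1
    unfold postIntegral valueLimit
    exact lintegral_iSup
      (fun n => (M.measurable_valueIter n).comp (M.measurable_post.comp measurable_prodMk_left))
      fun m n hmn y => M.valueIter_mono hmn _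

/-- The limit passes through the integral by monotone convergence, and through the minimum because
there are finitely many actions and the iterates increase. -/
theorem bellman_valueLimit : M.bellman M.valueLimit = M.valueLimit := by
  ext π
  have h1 : M.bellman M.valueLimit π = ⨆ n, M.bellman (M.valueIter n) π := by
    unfold bellman
    simp_rw [M.lookahead_valueLimit]
    exact (iSup_iInf_of_monotone fun u m n hmn => M.lookahead_mono (M.valueIter_mono hmn) u π).symm
  rw [h1]
  refine le_antisymm (iSup_le fun n => le_iSup (fun n => M.valueIter n π) (n + 1))
    (iSup_le fun n => ?_)
  exact (M.valueIter_mono (Nat.le_succ n) π).trans (le_iSup (fun n => M.valueIter (n + 1) π) n)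

theorem valueLimit_le_lookahead (u : Fin (L + 1)) (π : Fin X → ℝ) :
    M.valueLimit π ≤ M.lookahead M.valueLimit u π :=
  (congrFun M.bellman_valueLimit π).ge.trans (iInf_le _ u)

end SamplingModel
-- Homogeneous functions on the orthant: superadditivity and likelihood ratio monotonicity.
/-- Functions on the nonnegative orthant that are positively homogeneous and superadditive. -/
structure IsSuperlinear {X : ℕ} (f : (Fin X → ℝ) → ℝ≥0∞) : Prop where
  smul : ∀ a : ℝ, 0 ≤ a → ∀ p, 0 ≤ p → f (a • p) = ENNReal.ofReal a * f p
  add : ∀ p q, 0 ≤ p → 0 ≤ q → f p + f q ≤ f (p + q)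

theorem IsSuperlinear.zero {X : ℕ} {f : (Fin X → ℝ) → ℝ≥0∞} (hf : IsSuperlinear f) :
    f 0 = 0 := by
  simpa using hf.smul 0 le_rfl 0 le_rfl

theorem IsSuperlinear.iSup {X : ℕ} {f : ℕ → (Fin X → ℝ) → ℝ≥0∞} (hm : Monotone f)
    (hf : ∀ n, IsSuperlinear (f n)) : IsSuperlinear fun p => ⨆ n, f n p where
  smul a ha p hp := by simp_rw [(hf _).smul a ha p hp, ENNReal.mul_iSup]
  add p q hp hq := by
    rw [ENNReal.iSup_add_iSup_of_monotone (fun m n h => hm h p) fun m n h => hm h q]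
    exact iSup_mono fun n => (hf n).add p q hp hq

theorem IsSuperlinear.iInf {X : ℕ} {ι : Type*} [Nonempty ι] {f : ι → (Fin X → ℝ) → ℝ≥0∞}
    (hf : ∀ n, IsSuperlinear (f n)) : IsSuperlinear fun p => ⨅ n, f n p where
  smul a ha p hp := by
    simp_rw [(hf _).smul a ha p hp]
    exact (ENNReal.mul_iInf fun h => absurd h ENNReal.ofReal_ne_top).symm
  add p q hp hq := le_iInf fun n =>
    (add_le_add (iInf_le _ n) (iInf_le _ n)).trans ((hf n).add p q hp hq)

/-- Monotonicity of a homogeneous function in the likelihood ratio order, without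
normalization of the arguments. -/
def IsMLRMono {X : ℕ} (f : (Fin X → ℝ) → ℝ≥0∞) : Prop :=
  ∀ p q : Fin X → ℝ, 0 ≤ p → 0 ≤ q → MLRGe p q →
    f q * ENNReal.ofReal (∑ i, p i) ≤ f p * ENNReal.ofReal (∑ i, q i)

theorem IsMLRMono.iSup {X : ℕ} {ι : Type*} {f : ι → (Fin X → ℝ) → ℝ≥0∞}
    (hf : ∀ n, IsMLRMono (f n)) : IsMLRMono fun p => ⨆ n, f n p := fun p q hp hq hpq => by
  simp only [ENNReal.iSup_mul]
  exact iSup_mono fun n => hf n p q hp hq hpq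

theorem IsMLRMono.iInf {X : ℕ} {ι : Type*} [Finite ι] [Nonempty ι] {f : ι → (Fin X → ℝ) → ℝ≥0∞}
    (hf : ∀ n, IsMLRMono (f n)) : IsMLRMono fun p => ⨅ n, f n p := fun p q hp hq hpq => by
  obtain ⟨n, hn⟩ := exists_eq_ciInf_of_finite (f := fun n => f n p)
  simp only [← hn]
  exact (mul_le_mul_left (iInf_le _ n) _).trans (hf n p q hp hq hpq)

/-- The exchange inequality behind the monotonicity of posterior expectations: `v` and `s` stand
for the values and the total masses of the unnormalized posteriors of two priors `p`, `q` after
a smaller and a larger observation (primed). -/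
theorem exchange_le {vp vp' vq vq' sp sp' sq sq' : ℝ≥0∞}
    (hvp : vp ≠ ∞) (hvp' : vp' ≠ ∞) (hvq : vq ≠ ∞) (hvq' : vq' ≠ ∞)
    (hsp : sp ≠ ∞) (hsp' : sp' ≠ ∞) (hsq : sq ≠ ∞) (hsq' : sq' ≠ ∞)
    (zq : sq = 0 → vq = 0) (zq' : sq' = 0 → vq' = 0)
    (h1 : vq * sp ≤ vp * sq) (h2 : vq' * sp' ≤ vp' * sq') (h3 : vq * sq' ≤ vq' * sq)
    (h4 : vq * sp' ≤ vp' * sq) (h5 : sp * sq' ≤ sq * sp') :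
    vq * sp' + vq' * sp ≤ vp * sq' + vp' * sq := by
  lift vp to NNReal using hvp
  lift vp' to NNReal using hvp'
  lift vq to NNReal using hvq
  lift vq' to NNReal using hvq'
  lift sp to NNReal using hsp
  lift sp' to NNReal using hsp'
  lift sq to NNReal using hsq
  lift sq' to NNReal using hsq'
  norm_cast at *
  -- The masses `sq` and `sq'` are to be divided by, so their zeros are treated first; the cross
  -- comparison `h4` settles the case `sq' = 0`.
  rcases eq_or_ne sq' 0 with h | hq'
  · rw [zq' h, h]
    simpa using h4
  rcases eq_or_ne sq 0 with h | hq
  · have hp : sp = 0 := by simpa [h, hq'] using h5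
    simp [zq h, hp]
  have hq : 0 < (sq : ℝ) := by positivity
  have hq' : 0 < (sq' : ℝ) := by positivity
  rw [← NNReal.coe_le_coe] at *
  push_cast at *
  have e1 : (vq : ℝ) / sq * (sp * sq') ≤ vp * sq' := by
    rw [div_mul_eq_mul_div, div_le_iff₀ hq]
    nlinarith
  have e2 : (vq' : ℝ) / sq' * (sq * sp') ≤ vp' * sq := by
    rw [div_mul_eq_mul_div, div_le_iff₀ hq']
    nlinarith
  have e3 : (vq : ℝ) / sq ≤ vq' / sq' := by
    rw [div_le_div_iff₀ hq hq']
    exact h3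
  have e4 : (vq : ℝ) * sp' = vq / sq * (sq * sp') := by field_simp
  have e5 : (vq' : ℝ) * sp = vq' / sq' * (sp * sq') := by field_simp
  -- After bounding `vp` and `vp'` below through `q`, what remains is the rearrangement inequality
  -- `(vq'/sq' - vq/sq) * (sq * sp' - sp * sq') ≥ 0`.
  nlinarith [mul_nonneg (sub_nonneg.2 e3) (sub_nonneg.2 h5)]

/-! ### Value iteration preserves superlinearity and likelihood ratio monotonicity. -/

namespace SamplingModel

variable {X L : ℕ} {Y : Type*} [MeasurableSpace Y] (M : SamplingModel X L Y)

theorem cost_nonneg (hC : ∀ u i, 0 ≤ M.costVec u i) (u : Fin (L + 1)) {p : Fin X → ℝ}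
    (hp : 0 ≤ p) : 0 ≤ M.cost u p :=
  dotProduct_nonneg_of_nonneg (hC u) hp

theorem cost_add (u : Fin (L + 1)) (p q : Fin X → ℝ) :
    M.cost u (p + q) = M.cost u p + M.cost u q :=
  dotProduct_add _ _ _

theorem cost_smul (u : Fin (L + 1)) (a : ℝ) (p : Fin X → ℝ) :
    M.cost u (a • p) = a * M.cost u p :=
  dotProduct_smul _ _ _

theorem isSuperlinear_postIntegral {f : (Fin X → ℝ) → ℝ≥0∞} (hf : IsSuperlinear f) :
    IsSuperlinear (M.postIntegral f) where
  smul a ha p hp := by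
    simp only [postIntegral, M.post_smul, hf.smul a ha _ (M.post_nonneg hp _)]
    exact lintegral_const_mul' _ _ ENNReal.ofReal_ne_top
  add p q hp hq := (le_lintegral_add _ _).trans <| lintegral_mono fun y => by
    rw [M.post_add]
    exact hf.add _ _ (M.post_nonneg hp y) (M.post_nonneg hq y)

theorem isSuperlinear_lookahead (hC : ∀ u i, 0 ≤ M.costVec u i) {f : (Fin X → ℝ) → ℝ≥0∞}
    (hf : IsSuperlinear f) (u : Fin (L + 1)) : IsSuperlinear (M.lookahead f u) where
  smul a ha p hp := by
    simp only [lookahead, M.cost_smul, M.pred_smul, ENNReal.ofReal_mul ha, mul_add]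
    split_ifs
    · simp
    · rw [(M.isSuperlinear_postIntegral hf).smul a ha _ (M.pred_nonneg u hp)]
  add p q hp hq := by
    simp only [lookahead, M.cost_add, M.pred_add,
      ENNReal.ofReal_add (M.cost_nonneg hC u hp) (M.cost_nonneg hC u hq)]
    split_ifs
    · simp
    · rw [add_add_add_comm]
      gcongr
      exact (M.isSuperlinear_postIntegral hf).add _ _ (M.pred_nonneg u hp) (M.pred_nonneg u hq)

theorem isSuperlinear_valueIter (hC : ∀ u i, 0 ≤ M.costVec u i) (n : ℕ) :
    IsSuperlinear (M.valueIter n) := by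
  induction n with
  | zero => exact ⟨fun a _ p _ => by simp [valueIter], fun p q _ _ => by simp [valueIter]⟩
  | succ n ih => exact IsSuperlinear.iInf fun u => M.isSuperlinear_lookahead hC ih u

theorem isSuperlinear_valueLimit (hC : ∀ u i, 0 ≤ M.costVec u i) :
    IsSuperlinear M.valueLimit :=
  IsSuperlinear.iSup M.valueIter_mono (M.isSuperlinear_valueIter hC)

theorem valueIter_ne_top (n : ℕ) (p : Fin X → ℝ) : M.valueIter n p ≠ ∞ := by
  cases n with
  | zero => simp [valueIter]
  | succ n =>
    refine ne_top_of_le_ne_top ?_ (iInf_le _ (0 : Fin (L + 1)))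
    simp [lookahead]

theorem valueLimit_ne_top (p : Fin X → ℝ) : M.valueLimit p ≠ ∞ := by
  refine ne_top_of_le_ne_top ?_ (M.valueLimit_le_lookahead 0 p)
  simp [lookahead]

/-- The total mass of a prior is the integral of its posterior masses, so each side is a double
integral over two observations. The integrands need not be ordered pointwise, but their
symmetrizations in `(y, y')` are, by `exchange_le`. -/
theorem A3.isMLRMono_postIntegral {M : SamplingModel X L Y} [LinearOrder Y] (h3 : M.A3)
    {f : (Fin X → ℝ) → ℝ≥0∞} (hf : IsMLRMono f) (h0 : f 0 = 0) (hfin : ∀ p, f p ≠ ∞)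
    (hm : Measurable f) : IsMLRMono (M.postIntegral f) := by
  intro p q hp hq hpq
  set s : (Fin X → ℝ) → Y → ℝ≥0∞ := fun r y => ENNReal.ofReal (∑ j, M.post r y j) with hs
  have hz : ∀ r : Fin X → ℝ, 0 ≤ r → ∀ y, s r y = 0 → f (M.post r y) = 0 := fun r hr y h => by
    have hnn := M.post_nonneg hr y
    have h' := le_antisymm (ENNReal.ofReal_eq_zero.1 h) (Finset.sum_nonneg fun j _ => hnn j)
    rw [post_of_sum_eq_zero hnn h', h0]
  have hqq : MLRGe q q := fun i j _ => le_rfl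
  have hlt : ∀ y y', y < y' →
      f (M.post q y) * s p y' + f (M.post q y') * s p y ≤
        f (M.post p y) * s q y' + f (M.post p y') * s q y := fun y y' hy => by
    refine exchange_le (hfin _) (hfin _) (hfin _) (hfin _) ENNReal.ofReal_ne_top
      ENNReal.ofReal_ne_top ENNReal.ofReal_ne_top ENNReal.ofReal_ne_top
      (hz q hq y) (hz q hq y')
      (hf _ _ (M.post_nonneg hp y) (M.post_nonneg hq y) (M.mlrGe_post hpq y))
      (hf _ _ (M.post_nonneg hp y') (M.post_nonneg hq y') (M.mlrGe_post hpq y'))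
      (hf _ _ (M.post_nonneg hq y') (M.post_nonneg hq y) (h3.mlrGe_post hq hq hqq hy))
      (hf _ _ (M.post_nonneg hp y') (M.post_nonneg hq y) (h3.mlrGe_post hp hq hpq hy)) ?_
    simp only [hs]
    rw [← ENNReal.ofReal_mul (Finset.sum_nonneg fun j _ => M.post_nonneg hp y j),
      ← ENNReal.ofReal_mul (Finset.sum_nonneg fun j _ => M.post_nonneg hq y j)]
    exact ENNReal.ofReal_le_ofReal (h3.sum_post_mul_le hpq hy)
  have hpair : ∀ y y',
      f (M.post q y) * s p y' + f (M.post q y') * s p y ≤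
        f (M.post p y) * s q y' + f (M.post p y') * s q y := fun y y' => by
    rcases lt_trichotomy y y' with h | rfl | h
    · exact hlt y y' h
    · have := hf _ _ (M.post_nonneg hp y) (M.post_nonneg hq y) (M.mlrGe_post hpq y)
      exact add_le_add this this
    · rw [add_comm, add_comm (f (M.post p y) * s q y')]
      exact hlt y' y h
  have hms : ∀ r, Measurable (s r) := fun r =>
    (Finset.measurable_sum _ fun j _ => (M.B_measurable j).mul_const _).ennreal_ofReal
  have hmf : ∀ r, Measurable fun y => f (M.post r y) := fun r =>
    hm.comp (M.measurable_post.comp measurable_prodMk_left)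
  -- The two symmetric terms have the same double integral, which accounts for the factor `2`,
  -- cancelled at the end.
  have hint : ∀ r r' : Fin X → ℝ, 0 ≤ r' →
      ∫⁻ y, ∫⁻ y', (f (M.post r y) * s r' y' + f (M.post r y') * s r' y) ∂M.ν ∂M.ν =
        2 * (M.postIntegral f r * ENNReal.ofReal (∑ i, r' i)) := fun r r' hr' => by
    have h1 : ∀ y, ∫⁻ y', (f (M.post r y) * s r' y' + f (M.post r y') * s r' y) ∂M.ν =
        f (M.post r y) * ENNReal.ofReal (∑ i, r' i) + M.postIntegral f r * s r' y := fun y => by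
      rw [lintegral_add_left ((hms r').const_mul _), lintegral_const_mul _ (hms r'),
        lintegral_mul_const _ (hmf r), hs, M.lintegral_sum_post hr', postIntegral]
    simp_rw [h1]
    rw [lintegral_add_left ((hmf r).mul_const _), lintegral_mul_const _ (hmf r),
      lintegral_const_mul _ (hms r'), hs, M.lintegral_sum_post hr', two_mul, postIntegral]
  have h := lintegral_mono (μ := M.ν) fun y => lintegral_mono (μ := M.ν) fun y' => hpair y y'
  rw [hint q p hp, hint p q hq] at h
  exact (ENNReal.mul_le_mul_iff_right two_ne_zero ENNReal.ofNat_ne_top).1 h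

theorem isMLRMono_cost {u : Fin (L + 1)} (hu : Monotone (M.costVec u)) :
    IsMLRMono fun p => ENNReal.ofReal (M.cost u p) := fun p q hp hq hpq => by
  have h := hpq.sum_mul_dotProduct_le hu
  rw [dotProduct_comm, dotProduct_comm p] at h
  simp only
  rw [mul_comm, mul_comm (ENNReal.ofReal (M.cost u p)),
    ← ENNReal.ofReal_mul (Finset.sum_nonneg fun i _ => hp i),
    ← ENNReal.ofReal_mul (Finset.sum_nonneg fun i _ => hq i)]
  exact ENNReal.ofReal_le_ofReal h

theorem isMLRMono_valueIter {M : SamplingModel X L Y} [LinearOrder Y]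
    (hC : ∀ u i, 0 ≤ M.costVec u i) (h1 : ∀ u, Monotone (M.costVec u)) (h2 : M.A2) (h3 : M.A3)
    (n : ℕ) : IsMLRMono (M.valueIter n) := by
  induction n with
  | zero => intro p q _ _ _; simp [valueIter]
  | succ n ih =>
    refine IsMLRMono.iInf fun u p q hp hq hpq => ?_
    simp only [lookahead, add_mul]
    refine add_le_add (M.isMLRMono_cost (h1 u) p q hp hq hpq) ?_
    split_ifs
    · simp
    · have h := h3.isMLRMono_postIntegral ih (M.isSuperlinear_valueIter hC n).zero
        (M.valueIter_ne_top n) (M.measurable_valueIter n) _ _ (M.pred_nonneg u hp)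
        (M.pred_nonneg u hq) (hpq.transpose_pow_mulVec h2 (M.D u))
      rwa [M.sum_pred, M.sum_pred] at h

theorem isMLRMono_valueLimit {M : SamplingModel X L Y} [LinearOrder Y]
    (hC : ∀ u i, 0 ≤ M.costVec u i) (h1 : ∀ u, Monotone (M.costVec u)) (h2 : M.A2) (h3 : M.A3) :
    IsMLRMono M.valueLimit :=
  IsMLRMono.iSup (isMLRMono_valueIter hC h1 h2 h3)

/-- The expected cost to go decreases with the delay. -/
theorem postIntegral_pred_le {M : SamplingModel X L Y} [LinearOrder Y]
    (hC : ∀ u i, 0 ≤ M.costVec u i) (h1 : ∀ u, Monotone (M.costVec u)) (h2 : M.A2) (h3 : M.A3)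
    (h6 : M.A6) {π : Fin X → ℝ} (hπ : π ∈ stdSimplex ℝ (Fin X)) {u v : Fin (L + 1)}
    (hu : u ≠ 0) (huv : M.D u ≤ M.D v) :
    M.postIntegral M.valueLimit (M.pred π v) ≤ M.postIntegral M.valueLimit (M.pred π u) := by
  have hmono := h3.isMLRMono_postIntegral (isMLRMono_valueLimit hC h1 h2 h3)
    (M.isSuperlinear_valueLimit hC).zero M.valueLimit_ne_top M.measurable_valueLimit
  -- The exponent is `d + 1` because `A ⪰ A²` compares only positive powers; delays of continuing
  -- actions are positive.
  have key : Antitone fun d : ℕ =>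
      M.postIntegral M.valueLimit ((M.Aᵀ ^ (d + 1)) *ᵥ π) := antitone_nat_of_succ_le fun d => by
    have h := hmono _ _ (M.transpose_pow_mulVec_nonneg (d + 1) hπ.1)
      (M.transpose_pow_mulVec_nonneg (d + 2) hπ.1) (A6.mlrGe_transpose_pow h2 h6 hπ.1 d)
    simpa [M.sum_transpose_pow_mulVec, hπ.2] using h
  have hu' := M.D_pos u hu
  have h := key (show M.D u - 1 ≤ M.D v - 1 by omega)
  simp only at h
  rwa [Nat.sub_add_cancel hu', Nat.sub_add_cancel (hu'.trans_le huv)] at h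

end SamplingModel
/-! ### The controlled process -/

/-- One step of a chain that is killed on leaving the set `C`. -/
noncomputable def killedStep {S : Type*} [MeasurableSpace S] (η : Kernel S S) (C : S → Prop) [DecidablePred C]
    (f : S → ℝ≥0∞) (s : S) : ℝ≥0∞ := if C s then ∫⁻ t, f t ∂η s else 0

theorem measurable_killedStep {S : Type*} [MeasurableSpace S] (η : Kernel S S) {C : S → Prop}
    [DecidablePred C] (hC : MeasurableSet {s | C s}) {f : S → ℝ≥0∞} (hf : Measurable f) :
    Measurable (killedStep η C f) :=
  Measurable.ite hC hf.lintegral_kernel measurable_const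

theorem measurable_killedStep_iterate {S : Type*} [MeasurableSpace S] (η : Kernel S S)
    {C : S → Prop} [DecidablePred C] (hC : MeasurableSet {s | C s}) {f : S → ℝ≥0∞}
    (hf : Measurable f) (k : ℕ) : Measurable ((killedStep η C)^[k] f) := by
  induction k with
  | zero => exact hf
  | succ k ih =>
    rw [Function.iterate_succ_apply']
    exact measurable_killedStep η hC ih

/-- Expectations along a time-homogeneous Markov chain up to the first exit from `C`. -/
theorem lintegral_traj_ite_forall_lt {S : Type*} [MeasurableSpace S] (η : Kernel S S)
    [IsMarkovKernel η] {C : S → Prop} [DecidablePred C] (hC : MeasurableSet {s | C s}) (s : S)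
    (k : ℕ) {f : S → ℝ≥0∞} (hf : Measurable f) :
    ∫⁻ ω, (if ∀ j < k, C (ω j) then f (ω k) else 0) ∂(Kernel.traj (X := fun _ => S)
      (fun n => η.comap (fun h => h ⟨n, Finset.mem_Iic.2 le_rfl⟩) (measurable_pi_apply _)) 0
        fun _ => s) = (killedStep η C)^[k] f s := by
  set κ : (n : ℕ) → Kernel (∀ _ : Finset.Iic n, S) S :=
    fun n => η.comap (fun h => h ⟨n, Finset.mem_Iic.2 le_rfl⟩) (measurable_pi_apply _) with hκ
  induction k generalizing f with
  | zero =>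
    have h := lintegral_map (μ := Kernel.traj (X := fun _ => S) κ 0 fun _ => s)
      (f := fun r : (∀ _ : Finset.Iic 0, S) => f (r ⟨0, Finset.mem_Iic.2 le_rfl⟩))
      (hf.comp (measurable_pi_apply _)) (Preorder.measurable_frestrictLe 0)
    rw [Kernel.traj_map_frestrictLe_apply, Kernel.partialTraj_self, Kernel.id_apply,
      lintegral_dirac' (fun _ => s)
        (f := fun r : (∀ _ : Finset.Iic 0, S) => f (r ⟨0, Finset.mem_Iic.2 le_rfl⟩))
        (hf.comp (measurable_pi_apply _))] at h
    simpa using h.symm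
  | succ k ih =>
    have hset : MeasurableSet {r : (∀ _ : Finset.Iic k, S) | ∀ j, C (r j)} := by
      rw [Set.ofPred_forall]
      exact MeasurableSet.iInter fun j => measurable_pi_apply j hC
    set G : (∀ _ : Finset.Iic k, S) × S → ℝ≥0∞ :=
      fun z => if ∀ j, C (z.1 j) then f z.2 else 0 with hG
    have hGm : Measurable G :=
      Measurable.ite (measurable_fst hset) (hf.comp measurable_snd) measurable_const
    have h1 := lintegral_map (μ := Kernel.traj (X := fun _ => S) κ 0 fun _ => s) hGm
      ((Preorder.measurable_frestrictLe k).prodMk (measurable_pi_apply (k + 1)))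
    rw [← Kernel.partialTraj_compProd_eq_map_traj (Nat.zero_le k), Measure.lintegral_compProd hGm,
      ← Kernel.traj_map_frestrictLe_apply, lintegral_map hGm.lintegral_kernel_prod_right'
        (Preorder.measurable_frestrictLe k)] at h1
    -- The last transition is integrated out given the path up to time `k`, which replaces `f` by
    -- its killed step; hence the induction is over all `f`.
    rw [Function.iterate_succ_apply, ← ih (measurable_killedStep η hC hf)]
    refine Eq.trans ?_ (h1.symm.trans ?_)
    · refine lintegral_congr fun ω => ?_
      simp only [hG]
      refine if_congr ⟨fun h j => h j (Nat.lt_succ_of_le (Finset.mem_Iic.1 j.2)),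
        fun h j hj => h ⟨j, Finset.mem_Iic.2 (Nat.le_of_lt_succ hj)⟩⟩ rfl rfl
    · refine lintegral_congr fun ω => ?_
      have hiff : (∀ j : Finset.Iic k, C (ω j)) ↔ (∀ j < k, C (ω j)) ∧ C (ω k) :=
        ⟨fun h => ⟨fun j hj => h ⟨j, Finset.mem_Iic.2 hj.le⟩, h ⟨k, Finset.mem_Iic.2 le_rfl⟩⟩,
          fun h j => (Finset.mem_Iic.1 j.2).lt_or_eq.elim (h.1 j) fun e => by rw [e]; exact h.2⟩
      have hGω : ∀ t, G (Preorder.frestrictLe k ω, t) =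
          if ∀ j < k, C (ω j) then if C (ω k) then f t else 0 else 0 := fun t => by
        rw [← ite_and]
        exact if_congr hiff rfl rfl
      simp_rw [hGω]
      change ∫⁻ t, _ ∂η (ω k) = _
      unfold killedStep
      split_ifs <;> simp

namespace SamplingModel

variable {X L : ℕ} {Y : Type*} [MeasurableSpace Y] (M : SamplingModel X L Y)

/-- The expectation of `f` of the next belief, counted as zero if `μ` stops. -/
noncomputable def beliefStep (μ : Strategy X L) (f : (Fin X → ℝ) → ℝ≥0∞) (π : Fin X → ℝ) : ℝ≥0∞ :=
  if μ.1 π = 0 then 0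
  else ∫⁻ y, f (M.filter π y (μ.1 π)) * ENNReal.ofReal (M.sigma π y (μ.1 π)) ∂M.ν

/-- The cost incurred at a decision time. -/
noncomputable def stageCost (μ : Strategy X L) (π : Fin X → ℝ) : ℝ≥0∞ := ENNReal.ofReal (M.cost (μ.1 π) π)

theorem measurable_stageCost (μ : Strategy X L) : Measurable (M.stageCost μ) := by
  have h : Measurable fun z : (Fin X → ℝ) × Fin (L + 1) => ENNReal.ofReal (M.cost z.2 z.1) :=
    measurable_from_prod_countable_left fun u =>
      show Measurable fun π => ENNReal.ofReal (M.cost u π) from (M.measurable_cost u).ennreal_ofReal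
  have h' : Measurable fun π => (π, μ.1 π) := measurable_id.prodMk μ.2
  have h'' := h.comp h'
  exact h''

theorem sigma_nonneg {π : Fin X → ℝ} (hπ : 0 ≤ π) (y : Y) (u : Fin (L + 1)) :
    0 ≤ M.sigma π y u :=
  Finset.sum_nonneg fun j _ => M.post_nonneg (M.pred_nonneg u hπ) y j

/-- This includes `σ = 0`: a non-negative posterior of mass zero vanishes, so the value of the
filter there is immaterial. -/
theorem sigma_smul_filter {π : Fin X → ℝ} (hπ : 0 ≤ π) (y : Y) (u : Fin (L + 1)) :
    M.sigma π y u • M.filter π y u = M.post (M.pred π u) y := by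
  have hnn := M.post_nonneg (M.pred_nonneg u hπ) y
  rcases eq_or_ne (M.sigma π y u) 0 with h | h
  · rw [h, zero_smul, post_of_sum_eq_zero hnn h]
  · ext j
    simp only [Pi.smul_apply, smul_eq_mul, filter, post]
    field_simp

theorem filter_nonneg {π : Fin X → ℝ} (hπ : 0 ≤ π) (y : Y) (u : Fin (L + 1)) :
    0 ≤ M.filter π y u := fun j =>
  div_nonneg (M.post_nonneg (M.pred_nonneg u hπ) y j) (M.sigma_nonneg hπ y u)

theorem filter_mem_stdSimplex {π : Fin X → ℝ} (hπ : 0 ≤ π) {y : Y} {u : Fin (L + 1)}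
    (h : M.sigma π y u ≠ 0) : M.filter π y u ∈ stdSimplex ℝ (Fin X) :=
  ⟨M.filter_nonneg hπ y u, by
    simp only [filter]
    rw [← Finset.sum_div]
    exact div_self h⟩

/-- Only the values of `f` on the simplex matter for posterior expectations. -/
theorem mul_sigma_le_mul_sigma {f g : (Fin X → ℝ) → ℝ≥0∞}
    (hfg : ∀ ρ ∈ stdSimplex ℝ (Fin X), f ρ ≤ g ρ) {π : Fin X → ℝ} (hπ : 0 ≤ π) (y : Y)
    (u : Fin (L + 1)) :
    f (M.filter π y u) * ENNReal.ofReal (M.sigma π y u) ≤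
      g (M.filter π y u) * ENNReal.ofReal (M.sigma π y u) := by
  rcases eq_or_ne (M.sigma π y u) 0 with h | h
  · simp [h]
  · gcongr
    exact hfg _ (M.filter_mem_stdSimplex hπ h)

theorem beliefStep_mono (μ : Strategy X L) {f g : (Fin X → ℝ) → ℝ≥0∞}
    (hfg : ∀ ρ ∈ stdSimplex ℝ (Fin X), f ρ ≤ g ρ) {π : Fin X → ℝ} (hπ : 0 ≤ π) :
    M.beliefStep μ f π ≤ M.beliefStep μ g π := by
  unfold beliefStep
  split_ifs
  · exact le_rfl
  · exact lintegral_mono fun y => M.mul_sigma_le_mul_sigma hfg hπ y _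

theorem beliefStep_congr (μ : Strategy X L) {f g : (Fin X → ℝ) → ℝ≥0∞}
    (hfg : ∀ ρ ∈ stdSimplex ℝ (Fin X), f ρ = g ρ) {π : Fin X → ℝ} (hπ : 0 ≤ π) :
    M.beliefStep μ f π = M.beliefStep μ g π :=
  le_antisymm (M.beliefStep_mono μ (fun ρ hρ => (hfg ρ hρ).le) hπ)
    (M.beliefStep_mono μ (fun ρ hρ => (hfg ρ hρ).ge) hπ)

theorem measurable_beliefStep (μ : Strategy X L) {f : (Fin X → ℝ) → ℝ≥0∞} (hf : Measurable f) :
    Measurable (M.beliefStep μ f) := by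
  have := M.sigmaFinite
  have h : Measurable fun z : (Fin X → ℝ) × Fin (L + 1) =>
      ∫⁻ y, f (M.filter z.1 y z.2) * ENNReal.ofReal (M.sigma z.1 y z.2) ∂M.ν := by
    refine measurable_from_prod_countable_left fun u => ?_
    change Measurable fun π =>
      ∫⁻ y, f (M.filter π y u) * ENNReal.ofReal (M.sigma π y u) ∂M.ν
    refine Measurable.lintegral_prod_right' (f := fun z : (Fin X → ℝ) × Y =>
      f (M.filter z.1 z.2 u) * ENNReal.ofReal (M.sigma z.1 z.2 u)) ?_
    refine (hf.comp (M.measurable_filter u)).mul (Measurable.ennreal_ofReal ?_)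
    exact Finset.measurable_sum _ fun j _ => ((M.B_measurable j).comp measurable_snd).mul
      ((measurable_pi_apply j).comp ((M.measurable_pred u).comp measurable_fst))
  have h' : Measurable fun π => (π, μ.1 π) := measurable_id.prodMk μ.2
  have h'' := h.comp h'
  exact Measurable.ite (μ.2 (measurableSet_singleton 0)) measurable_const h''

/-- Expectations under the one-step transition kernel. -/
theorem lintegral_transition (μ : Strategy X L) (i : Fin X) (π : Fin X → ℝ)
    {f : Fin X × (Fin X → ℝ) → ℝ≥0∞} (hf : Measurable f) :
    ∫⁻ s, f s ∂M.transition μ (i, π) = ∑ x, ENNReal.ofReal ((M.A ^ M.D (μ.1 π)) i x) *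
      ∫⁻ y, ENNReal.ofReal (M.B x y) * f (x, M.filter π y (μ.1 π)) ∂M.ν := by
  have hm : Measurable fun z : Fin X × Y => f (z.1, M.filter π z.2 (μ.1 π)) :=
    hf.comp (measurable_fst.prodMk
      ((M.measurable_filter _).comp (measurable_const.prodMk measurable_snd)))
  have hstep : ∫⁻ s, f s ∂M.transition μ (i, π) =
      ∫⁻ z, f (z.1, M.filter π z.2 (μ.1 π)) ∂M.stepLaw (i, μ.1 π) := by
    rw [transition, Kernel.lintegral_map _ (M.measurable_update μ) _ hf,
      Kernel.lintegral_id_prod (f := fun z => f (M.update μ z))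
        (hf.comp (M.measurable_update μ)), Kernel.comap_apply]
    rfl
  rw [hstep]
  change ∫⁻ z, f (z.1, M.filter π z.2 (μ.1 π)) ∂(∑ x', ENNReal.ofReal
    ((M.A ^ M.D (μ.1 π)) i x') • (M.obsLaw x').map (fun y => (x', y))) = _
  rw [lintegral_finsetSum_measure]
  refine Finset.sum_congr rfl fun x _ => ?_
  rw [lintegral_smul_measure, lintegral_map hm measurable_prodMk_left, smul_eq_mul, obsLaw]
  congr 1
  exact lintegral_withDensity_eq_lintegral_mul _ (M.B_measurable x).ennreal_ofReal
    (hm.comp measurable_prodMk_left)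

/-- Correctness of the Bayesian filter: if the hidden state is distributed according to the
belief, then the same holds after one more observation. -/
theorem sum_mul_killedStep (μ : Strategy X L) {π : Fin X → ℝ} (hπ : 0 ≤ π)
    {f : Fin X × (Fin X → ℝ) → ℝ≥0∞} (hf : Measurable f) :
    ∑ i, ENNReal.ofReal (π i) * killedStep (M.transition μ) (fun s => μ.1 s.2 ≠ 0) f (i, π) =
      M.beliefStep μ (fun ρ => ∑ i, ENNReal.ofReal (ρ i) * f (i, ρ)) π := by
  unfold killedStep beliefStep
  by_cases h : μ.1 π = 0
  · simp [h]
  simp only [h, ne_eq, not_false_eq_true, if_true, if_false, M.lintegral_transition μ _ π hf]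
  set u := μ.1 π
  have hA := (Matrix.mem_rowStochastic_iff_sum.1 (M.A_pow_mem (M.D u))).1
  have hfm : ∀ x, Measurable fun y => ENNReal.ofReal (M.B x y) * f (x, M.filter π y u) :=
    fun x => (M.B_measurable x).ennreal_ofReal.mul (hf.comp (measurable_const.prodMk
      ((M.measurable_filter u).comp measurable_prodMk_left)))
  have hpred : ∀ x, ENNReal.ofReal (M.pred π u x) =
      ∑ i, ENNReal.ofReal (π i) * ENNReal.ofReal ((M.A ^ M.D u) i x) := fun x => by
    have h : M.pred π u x = ∑ i, (M.A ^ M.D u) i x * π i := by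
      rw [pred, ← Matrix.transpose_pow]
      rfl
    rw [h, ENNReal.ofReal_sum_of_nonneg fun i _ => mul_nonneg (hA i x) (hπ i)]
    exact Finset.sum_congr rfl fun i _ => by
      rw [ENNReal.ofReal_mul (hA i x), mul_comm]
  calc _ = ∑ x, ENNReal.ofReal (M.pred π u x) *
        ∫⁻ y, ENNReal.ofReal (M.B x y) * f (x, M.filter π y u) ∂M.ν := by
        simp_rw [hpred, Finset.mul_sum, Finset.sum_mul, mul_assoc]
        exact Finset.sum_comm
    _ = ∫⁻ y, ∑ x, ENNReal.ofReal (M.pred π u x) *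
        (ENNReal.ofReal (M.B x y) * f (x, M.filter π y u)) ∂M.ν := by
        rw [lintegral_finsetSum _ fun x _ => (hfm x).const_mul _]
        exact Finset.sum_congr rfl fun x _ => (lintegral_const_mul _ (hfm x)).symm
    _ = _ := by
        refine lintegral_congr fun y => ?_
        rw [Finset.sum_mul]
        refine Finset.sum_congr rfl fun x _ => ?_
        -- Bayes' rule: the joint weight of state `x` and observation `y` is `σ` times the updated
        -- belief in `x`.
        have hx := congrFun (M.sigma_smul_filter hπ y u) x
        simp only [Pi.smul_apply, smul_eq_mul, post] at hx
        rw [← mul_assoc, ← ENNReal.ofReal_mul (M.pred_nonneg u hπ x), mul_comm (M.pred π u x),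
          ← hx, ENNReal.ofReal_mul (M.sigma_nonneg hπ y u)]
        ring

theorem sum_ofReal_eq_one {π : Fin X → ℝ} (hπ : π ∈ stdSimplex ℝ (Fin X)) :
    ∑ i, ENNReal.ofReal (π i) = 1 := by
  rw [← ENNReal.ofReal_sum_of_nonneg fun i _ => hπ.1 i, hπ.2, ENNReal.ofReal_one]

/-- The hidden state stays distributed according to the belief, so it can be averaged out at every
step, leaving a recursion on beliefs. -/
theorem sum_mul_killedStep_iterate (μ : Strategy X L) {c : (Fin X → ℝ) → ℝ≥0∞}
    (hc : Measurable c) (k : ℕ) {π : Fin X → ℝ} (hπ : π ∈ stdSimplex ℝ (Fin X)) :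
    ∑ i, ENNReal.ofReal (π i) * (killedStep (M.transition μ) (fun s => μ.1 s.2 ≠ 0))^[k]
      (fun s => c s.2) (i, π) = (M.beliefStep μ)^[k] c π := by
  have hset : MeasurableSet {s : Fin X × (Fin X → ℝ) | μ.1 s.2 ≠ 0} :=
    (μ.2.comp measurable_snd) (measurableSet_singleton 0).compl
  induction k generalizing π with
  | zero => simp [← Finset.sum_mul, sum_ofReal_eq_one hπ]
  | succ k ih =>
    have hc' : Measurable fun s : Fin X × (Fin X → ℝ) => c s.2 := hc.comp measurable_snd
    rw [Function.iterate_succ_apply', Function.iterate_succ_apply',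
      M.sum_mul_killedStep μ hπ.1 (measurable_killedStep_iterate _ hset hc' k)]
    exact M.beliefStep_congr μ (fun ρ hρ => ih hρ) hπ.1

/-- The objective as the sum of the expected stage costs. -/
theorem objective_eq_tsum (μ : Strategy X L) {π : Fin X → ℝ} (hπ : π ∈ stdSimplex ℝ (Fin X)) :
    M.objective μ π = ∑' k, (M.beliefStep μ)^[k] (M.stageCost μ) π := by
  have hset : MeasurableSet {s : Fin X × (Fin X → ℝ) | μ.1 s.2 ≠ 0} :=
    (μ.2.comp measurable_snd) (measurableSet_singleton 0).compl
  have hc : Measurable fun s : Fin X × (Fin X → ℝ) => M.stageCost μ s.2 :=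
    (M.measurable_stageCost μ).comp measurable_snd
  have hpath : ∀ i, ∫⁻ ω, M.totalCost μ ω ∂M.pathLaw μ (i, π) =
      ∑' k, (killedStep (M.transition μ) (fun s => μ.1 s.2 ≠ 0))^[k]
        (fun s => M.stageCost μ s.2) (i, π) := fun i => by
    unfold totalCost pathLaw
    rw [lintegral_tsum]
    · refine tsum_congr fun k => ?_
      rw [← lintegral_traj_ite_forall_lt (M.transition μ) hset (i, π) k hc]
      refine lintegral_congr fun ω => ?_
      simp only [stageCost]
    · intro k
      refine (Measurable.ite ?_ (hc.comp (measurable_pi_apply k)) measurable_const).aemeasurable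
      simp only [Set.ofPred_forall]
      exact MeasurableSet.iInter fun j => MeasurableSet.iInter fun _ =>
        (measurable_pi_apply (X := fun _ : ℕ => Fin X × (Fin X → ℝ)) j) hset
  unfold objective
  simp_rw [hpath, ← ENNReal.tsum_mul_left]
  rw [← Summable.tsum_finsetSum fun i _ => ENNReal.summable]
  exact tsum_congr fun k => M.sum_mul_killedStep_iterate μ (M.measurable_stageCost μ) k hπ

end SamplingModel
-- The optimal cost as the limit of value iteration.
/-- Measurable selection of minimizers from a finite set. -/
theorem exists_measurable_argmin {α : Type*} [MeasurableSpace α] {n : ℕ}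
    {g : Fin (n + 1) → α → ℝ≥0∞} (hg : ∀ u, Measurable (g u)) :
    ∃ μ : α → Fin (n + 1), Measurable μ ∧ ∀ a u, g (μ a) a ≤ g u a := by
  -- Taking the least minimizer makes each level set of the selector a finite Boolean combination of
  -- comparison sets.
  have hex : ∀ a, ∃ u, (∀ v, g u a ≤ g v a) ∧ ∀ w < u, ¬ ∀ v, g w a ≤ g v a := fun a => by
    have hne : {u | ∀ v, g u a ≤ g v a}.Nonempty := Finite.exists_min fun u => g u a
    exact ⟨wellFounded_lt.min _ hne, wellFounded_lt.min_mem _ hne, fun w hw hw' =>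
      wellFounded_lt.not_lt_min {u | ∀ v, g u a ≤ g v a} hw' hw⟩
  choose μ hμ hμ' using hex
  refine ⟨μ, measurable_to_countable' fun u => ?_, hμ⟩
  have hmin : ∀ u, MeasurableSet {a | ∀ v, g u a ≤ g v a} := fun u => by
    rw [Set.ofPred_forall]
    exact MeasurableSet.iInter fun v => measurableSet_le (hg u) (hg v)
  have hset : μ ⁻¹' {u} =
      {a | ∀ v, g u a ≤ g v a} ∩ ⋂ w, ⋂ (_ : w < u), {a | ∀ v, g w a ≤ g v a}ᶜ := by
    ext a
    simp only [Set.mem_preimage, Set.mem_singleton_iff, Set.mem_inter_iff, Set.mem_iInter,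
      Set.mem_compl_iff]
    constructor
    · rintro rfl
      exact ⟨hμ a, hμ' a⟩
    · rintro ⟨h1, h2⟩
      rcases lt_trichotomy (μ a) u with h | h | h
      · exact absurd (hμ a) (h2 _ h)
      · exact h
      · exact absurd h1 (hμ' a u h)
  rw [hset]
  exact (hmin u).inter (MeasurableSet.iInter fun w => MeasurableSet.iInter fun _ => (hmin w).compl)

namespace SamplingModel

variable {X L : ℕ} {Y : Type*} [MeasurableSpace Y] (M : SamplingModel X L Y)

/-- For homogeneous `f`, the expectation of `f` of the next belief is an integral over
unnormalized posteriors. -/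
theorem lintegral_filter_mul_sigma {f : (Fin X → ℝ) → ℝ≥0∞} (hf : IsSuperlinear f)
    {π : Fin X → ℝ} (hπ : 0 ≤ π) (u : Fin (L + 1)) :
    ∫⁻ y, f (M.filter π y u) * ENNReal.ofReal (M.sigma π y u) ∂M.ν =
      M.postIntegral f (M.pred π u) := by
  refine lintegral_congr fun y => ?_
  rw [← M.sigma_smul_filter hπ, hf.smul _ (M.sigma_nonneg hπ y u) _ (M.filter_nonneg hπ y u),
    mul_comm]

theorem stageCost_add_beliefStep (μ : Strategy X L) {f : (Fin X → ℝ) → ℝ≥0∞}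
    (hf : IsSuperlinear f) {π : Fin X → ℝ} (hπ : 0 ≤ π) :
    M.stageCost μ π + M.beliefStep μ f π = M.lookahead f (μ.1 π) π := by
  simp only [stageCost, beliefStep, lookahead, M.lintegral_filter_mul_sigma hf hπ]

theorem measurable_beliefStep_iterate (μ : Strategy X L) (k : ℕ) :
    Measurable ((M.beliefStep μ)^[k] (M.stageCost μ)) := by
  induction k with
  | zero => exact M.measurable_stageCost μ
  | succ k ih =>
    rw [Function.iterate_succ_apply']
    exact M.measurable_beliefStep μ ih

theorem beliefStep_add (μ : Strategy X L) {f g : (Fin X → ℝ) → ℝ≥0∞} (hf : Measurable f)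
    (π : Fin X → ℝ) :
    M.beliefStep μ (f + g) π = M.beliefStep μ f π + M.beliefStep μ g π := by
  unfold beliefStep
  split_ifs
  · simp
  · have hm : Measurable fun y => f (M.filter π y (μ.1 π)) *
        ENNReal.ofReal (M.sigma π y (μ.1 π)) :=
      (hf.comp ((M.measurable_filter _).comp measurable_prodMk_left)).mul
        (Finset.measurable_sum _ fun j _ => (M.B_measurable j).mul_const _).ennreal_ofReal
    simp only [Pi.add_apply, add_mul]
    exact lintegral_add_left hm _

/-- The expected cost of the first `n` decisions. -/
noncomputable def partialCost (μ : Strategy X L) (n : ℕ) (π : Fin X → ℝ) : ℝ≥0∞ :=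
  ∑ k ∈ Finset.range n, (M.beliefStep μ)^[k] (M.stageCost μ) π

theorem measurable_partialCost (μ : Strategy X L) (n : ℕ) : Measurable (M.partialCost μ n) :=
  Finset.measurable_sum _ fun k _ => M.measurable_beliefStep_iterate μ k

theorem partialCost_succ (μ : Strategy X L) (n : ℕ) (π : Fin X → ℝ) :
    M.partialCost μ (n + 1) π = M.stageCost μ π + M.beliefStep μ (M.partialCost μ n) π := by
  induction n with
  | zero =>
    have : M.beliefStep μ (M.partialCost μ 0) π = 0 := by simp [beliefStep, partialCost]
    simp [this, partialCost]
  | succ n ih =>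
    have h : M.partialCost μ (n + 1) =
        M.partialCost μ n + (M.beliefStep μ)^[n] (M.stageCost μ) :=
      funext fun ρ => Finset.sum_range_succ _ _
    rw [h, M.beliefStep_add μ (M.measurable_partialCost μ n), ← add_assoc, ← ih,
      ← Function.iterate_succ_apply' (M.beliefStep μ)]
    exact Finset.sum_range_succ _ _

theorem objective_eq_iSup (μ : Strategy X L) {π : Fin X → ℝ} (hπ : π ∈ stdSimplex ℝ (Fin X)) :
    M.objective μ π = ⨆ n, M.partialCost μ n π := by
  rw [M.objective_eq_tsum μ hπ, ENNReal.tsum_eq_iSup_nat]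
  rfl

theorem valueIter_le_partialCost (hC : ∀ u i, 0 ≤ M.costVec u i) (μ : Strategy X L) (n : ℕ)
    {π : Fin X → ℝ} (hπ : π ∈ stdSimplex ℝ (Fin X)) :
    M.valueIter n π ≤ M.partialCost μ n π := by
  induction n generalizing π with
  | zero => exact zero_le
  | succ n ih =>
    rw [M.partialCost_succ]
    refine (iInf_le _ (μ.1 π)).trans ?_
    rw [← M.stageCost_add_beliefStep μ (M.isSuperlinear_valueIter hC n) hπ.1]
    gcongr
    exact M.beliefStep_mono μ (fun ρ hρ => ih hρ) hπ.1

/-- Value iteration converges to the optimal cost, which is attained by a stationary strategy. -/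
theorem value_eq_valueLimit (hC : ∀ u i, 0 ≤ M.costVec u i) {π : Fin X → ℝ}
    (hπ : π ∈ stdSimplex ℝ (Fin X)) : M.value π = M.valueLimit π := by
  apply le_antisymm
  -- For the strategy greedy with respect to the limit, the fixed-point equation bounds every
  -- partial cost by the limit, by induction on the number of stages.
  · obtain ⟨μ, hμ, hmin⟩ :=
      exists_measurable_argmin (M.measurable_lookahead M.measurable_valueLimit)
    refine (iInf_le _ (⟨μ, hμ⟩ : Strategy X L)).trans ?_
    rw [M.objective_eq_iSup _ hπ]
    refine iSup_le fun n => ?_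
    induction n generalizing π with
    | zero => simp [partialCost]
    | succ n ih =>
      rw [M.partialCost_succ]
      calc _ ≤ M.stageCost ⟨μ, hμ⟩ π + M.beliefStep ⟨μ, hμ⟩ M.valueLimit π := by
            gcongr
            exact M.beliefStep_mono _ (fun ρ hρ => ih hρ) hπ.1
        _ = M.lookahead M.valueLimit (μ π) π :=
            M.stageCost_add_beliefStep _ (M.isSuperlinear_valueLimit hC) hπ.1
        _ ≤ M.bellman M.valueLimit π := le_iInf fun u => hmin π u
        _ = _ := by rw [M.bellman_valueLimit]
  · refine le_iInf fun μ => iSup_le fun n => ?_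
    rw [M.objective_eq_iSup _ hπ]
    exact (M.valueIter_le_partialCost hC μ n hπ).trans
      (le_iSup (fun n => M.partialCost μ n π) n)

theorem Q_eq_lookahead (hC : ∀ u i, 0 ≤ M.costVec u i) {π : Fin X → ℝ}
    (hπ : π ∈ stdSimplex ℝ (Fin X)) (u : Fin (L + 1)) :
    M.Q π u = M.lookahead M.valueLimit u π := by
  unfold Q lookahead
  split_ifs with h
  · rw [h, add_zero]
  · rw [← M.lintegral_filter_mul_sigma (M.isSuperlinear_valueLimit hC) hπ.1]
    congr 1
    exact le_antisymm
      (lintegral_mono fun y => M.mul_sigma_le_mul_sigma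
        (fun ρ hρ => (M.value_eq_valueLimit hC hρ).le) hπ.1 y u)
      (lintegral_mono fun y => M.mul_sigma_le_mul_sigma
        (fun ρ hρ => (M.value_eq_valueLimit hC hρ).ge) hπ.1 y u)

/-! ### Structure of the optimal and of the myopic strategy -/

/-- Continuing has a concave cost and stopping a linear one, so the inequality between them passes
to convex combinations. -/
theorem convex_stoppingSet (hC : ∀ u i, 0 ≤ M.costVec u i) : Convex ℝ M.stoppingSet := by
  intro p hp q hq a b ha hb hab
  have hpq := convex_stdSimplex ℝ (Fin X) hp.1 hq.1 ha hb hab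
  have hap : 0 ≤ a • p := smul_nonneg ha hp.1.1
  have hbq : 0 ≤ b • q := smul_nonneg hb hq.1.1
  refine ⟨hpq, fun u hu => ?_⟩
  have hsl := M.isSuperlinear_lookahead hC (M.isSuperlinear_valueLimit hC) u
  have hp' := hp.2 u hu
  have hq' := hq.2 u hu
  rw [M.Q_eq_lookahead hC hp.1 u] at hp'
  rw [M.Q_eq_lookahead hC hq.1 u] at hq'
  rw [M.Q_eq_lookahead hC hpq u]
  refine le_trans ?_ (hsl.add _ _ hap hbq)
  rw [hsl.smul a ha p hp.1.1, hsl.smul b hb q hq.1.1]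
  refine le_trans (le_of_eq ?_) (add_le_add (mul_le_mul_right hp' _) (mul_le_mul_right hq' _))
  simp only [Q, if_true]
  rw [M.cost_add, M.cost_smul, M.cost_smul,
    ENNReal.ofReal_add (mul_nonneg ha (M.cost_nonneg hC 0 hp.1.1))
      (mul_nonneg hb (M.cost_nonneg hC 0 hq.1.1)), ENNReal.ofReal_mul ha, ENNReal.ofReal_mul hb]

theorem myopicStoppingSet_subset : M.myopicStoppingSet ⊆ M.stoppingSet := by
  refine fun π hπ => ⟨hπ.1, fun u hu => ?_⟩
  simp only [Q, if_true, if_neg hu]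
  exact (ENNReal.ofReal_le_ofReal (hπ.2 u hu).le).trans le_self_add

/-- Let `a` be myopic, `b` optimal and `b < a`. Outside the stopping set `b` continues, and `a`
beats or equals it both in immediate cost and in cost to go. So `a` is optimal too, and optimality
of `b` forces equal immediate costs, making `b` myopic. -/
theorem setLE_myopicActions_optimalActions {M : SamplingModel X L Y} [LinearOrder Y]
    (hC : ∀ u i, 0 ≤ M.costVec u i) (h1 : ∀ u, Monotone (M.costVec u)) (h2 : M.A2) (h3 : M.A3)
    (h6 : M.A6) (hD : ∀ u v : Fin (L + 1), u ≠ 0 → u < v → M.D u < M.D v) {π : Fin X → ℝ}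
    (hπ : π ∈ stdSimplex ℝ (Fin X)) (hS : π ∉ M.stoppingSet) :
    SetLE (M.myopicActions π) (M.optimalActions π) := by
  intro a ha b hb
  rcases le_or_gt a b with hab | hab
  · rw [min_eq_left hab, max_eq_right hab]
    exact ⟨ha, hb⟩
  rw [min_eq_right hab.le, max_eq_left hab.le]
  have hb0 : b ≠ 0 := by
    rintro rfl
    exact hS ⟨hπ, fun u _ => hb u⟩
  have ha0 : a ≠ 0 := ((Fin.zero_le b).trans_lt hab).ne'
  have hint := postIntegral_pred_le hC h1 h2 h3 h6 hπ hb0 (hD b a hb0 hab).le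
  have hQ : ∀ u, u ≠ 0 → M.Q π u =
      ENNReal.ofReal (M.cost u π) + M.postIntegral M.valueLimit (M.pred π u) := fun u hu => by
    rw [M.Q_eq_lookahead hC hπ, lookahead, if_neg hu]
  have hle : M.Q π a ≤ M.Q π b := by
    rw [hQ a ha0, hQ b hb0]
    exact add_le_add (ENNReal.ofReal_le_ofReal (ha b)) hint
  refine ⟨fun v => le_trans ?_ (ha v), fun v => hle.trans (hb v)⟩
  have hge := hb a
  rw [hQ a ha0, hQ b hb0] at hge
  -- Finiteness, needed to cancel the cost to go, comes from comparing `b` with stopping.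
  have hfin : M.postIntegral M.valueLimit (M.pred π b) ≠ ∞ := by
    have h : M.Q π b ≤ M.Q π 0 := hb 0
    rw [hQ b hb0] at h
    refine ne_top_of_le_ne_top ?_ (le_add_self.trans h)
    simp [Q]
  have h := (ENNReal.add_le_add_iff_right hfin).1 (hge.trans (add_le_add_right hint _))
  exact (ENNReal.ofReal_le_ofReal_iff (M.cost_nonneg hC a hπ.1)).1 h

/-- Submodular costs have decreasing differences in the likelihood ratio order. -/
theorem cost_sub_le_of_mlrGe {u v : Fin (L + 1)}
    (h : Antitone fun i => M.costVec v i - M.costVec u i) {π π' : Fin X → ℝ}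
    (hπ : π ∈ stdSimplex ℝ (Fin X)) (hπ' : π' ∈ stdSimplex ℝ (Fin X)) (hge : MLRGe π π') :
    M.cost v π - M.cost u π ≤ M.cost v π' - M.cost u π' := by
  have h' := hge.sum_mul_dotProduct_le h.neg
  rw [hπ.2, hπ'.2, one_mul, one_mul] at h'
  have e : ∀ p : Fin X → ℝ, (p ⬝ᵥ fun i => -(M.costVec v i - M.costVec u i)) =
      M.cost u p - M.cost v p := fun p => by
    simp only [cost, dotProduct, ← Finset.sum_sub_distrib]
    exact Finset.sum_congr rfl fun i _ => by ring
  have h'' : (π' ⬝ᵥ fun i => -(M.costVec v i - M.costVec u i)) ≤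
    π ⬝ᵥ fun i => -(M.costVec v i - M.costVec u i) := h'
  rw [e, e] at h''
  linarith

/-- Submodularity for consecutive actions implies submodularity. -/
theorem antitone_costVec_sub {a b : Fin (L + 1)} (hab : a ≤ b)
    (h : ∀ u v : Fin (L + 1), a ≤ u → (v : ℕ) = u + 1 →
      Antitone fun i => M.costVec v i - M.costVec u i) :
    Antitone fun i => M.costVec b i - M.costVec a i := by
  have key : ∀ k : ℕ, ∀ hk : (a : ℕ) + k < L + 1,
      Antitone fun i => M.costVec ⟨a + k, hk⟩ i - M.costVec a i := fun k => by
    induction k with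
    | zero => intro _; simpa using antitone_const
    | succ k ih =>
      intro hk i j hij
      have h1 := ih (by omega) hij
      have h2 := h ⟨a + k, by omega⟩ ⟨a + (k + 1), hk⟩ (Fin.le_def.2 (by simp)) (by simp; omega) hij
      simp only at h1 h2 ⊢
      linarith
  have hb := b.2
  have hab' : (a : ℕ) ≤ b := hab
  have := key (b - a) (by omega)
  have e : (⟨a + (b - a), by omega⟩ : Fin (L + 1)) = b := Fin.ext (by simp; omega)
  rwa [e] at this

/-- If `b < a`, with `a` minimal at `π'` and `b` at `π`, the cost of `a` minus that of `b` is at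
most `0` at `π'`, at least `0` at `π`, and no larger at `π` than at `π'`. Both differences vanish,
so the two actions are interchangeable. -/
theorem setLE_myopicContinueActions {M : SamplingModel X L Y} (h4 : M.A4) {π π' : Fin X → ℝ}
    (hπ : π ∈ stdSimplex ℝ (Fin X)) (hπ' : π' ∈ stdSimplex ℝ (Fin X)) (hge : MLRGe π π') :
    SetLE (M.myopicContinueActions π') (M.myopicContinueActions π) := by
  intro a ha b hb
  rcases le_or_gt a b with hab | hab
  · rw [min_eq_left hab, max_eq_right hab]
    exact ⟨ha, hb⟩
  rw [min_eq_right hab.le, max_eq_left hab.le]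
  -- Only actions from `b` upwards are chained, and `b ≠ 0`, so submodularity among continuing
  -- actions suffices.
  have h := M.cost_sub_le_of_mlrGe (M.antitone_costVec_sub hab.le fun u v hu hv =>
    h4 u v (fun h => hb.1 (Fin.le_zero_iff.1 (h ▸ hu))) hv) hπ hπ' hge
  have h1 := ha.2 b hb.1
  have h2 := hb.2 a ha.1
  exact ⟨⟨hb.1, fun v hv => by linarith [ha.2 v hv]⟩,
    ⟨ha.1, fun v hv => by linarith [hb.2 v hv]⟩⟩

theorem setLE_myopicActions {M : SamplingModel X L Y} (h4 : M.A4Full) {π π' : Fin X → ℝ}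
    (hπ : π ∈ stdSimplex ℝ (Fin X)) (hπ' : π' ∈ stdSimplex ℝ (Fin X)) (hge : MLRGe π π') :
    SetLE (M.myopicActions π') (M.myopicActions π) := by
  intro a ha b hb
  rcases le_or_gt a b with hab | hab
  · rw [min_eq_left hab, max_eq_right hab]
    exact ⟨ha, hb⟩
  rw [min_eq_right hab.le, max_eq_left hab.le]
  have h := M.cost_sub_le_of_mlrGe
    (M.antitone_costVec_sub hab.le fun u v _ hv => h4 u v hv) hπ hπ' hge
  have h1 := ha b
  have h2 := hb a
  exact ⟨fun v => by linarith [ha v], fun v => by linarith [hb v]⟩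

end SamplingModel

theorem theorem4 {X L : ℕ} [NeZero X] {Y : Type*} [MeasurableSpace Y] [LinearOrder Y]
    (M : SamplingModel X L Y) (hC : ∀ u i, 0 ≤ M.costVec u i) :
    Convex ℝ M.stoppingSet ∧
    M.myopicStoppingSet ⊆ M.stoppingSet ∧
    (M.A1 → M.A2 → M.A3 → M.A6 →
      (∀ u v : Fin (L + 1), u ≠ 0 → u < v → M.D u < M.D v) →
      ∀ π ∈ stdSimplex ℝ (Fin X) \ M.stoppingSet,
        SetLE (M.myopicActions π) (M.optimalActions π)) ∧
    (M.A4 → ∀ π ∈ stdSimplex ℝ (Fin X), ∀ π' ∈ stdSimplex ℝ (Fin X), MLRGe π π' →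
      SetLE (M.myopicContinueActions π') (M.myopicContinueActions π)) ∧
    (M.A4Full → ∀ π ∈ stdSimplex ℝ (Fin X), ∀ π' ∈ stdSimplex ℝ (Fin X), MLRGe π π' →
      SetLE (M.myopicActions π') (M.myopicActions π)) := by
  exact ⟨M.convex_stoppingSet hC, M.myopicStoppingSet_subset,
    fun h1 h2 h3 h6 hD π hπ =>
      SamplingModel.setLE_myopicActions_optimalActions hC h1.1 h2 h3 h6 hD hπ.1 hπ.2,
    fun h4 π hπ π' hπ' => SamplingModel.setLE_myopicContinueActions h4 hπ hπ',
    fun h4 π hπ π' hπ' => SamplingModel.setLE_myopicActions h4 hπ hπ'⟩
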